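/- Let $q$ be a prime power and let $f(x)=\sum_{n\ge 0}a_nx^n\in\mathbb F_q[[x]]$ be algebraic over $\mathbb F_q(x)$. Let $d=[\mathbb F_q(x)(f):\mathbb F_q(x)]$ be its degree and let $h$ be its height, i.e. the minimal degree in $x$ of a nonzero polynomial $Q(x,y)\in\mathbb F_q[x,y]$ with $Q(x,f(x))=0$. Let $P(x,y)\in\mathbb F_q[x,y]$ be the minimal polynomial of $f$, i.e. the irreducible polynomial in $\mathbb F_q[x,y]$, unique up to a nonzero constant, with $P(x,f(x))=0$. Let $\overrightarrow{\mathrm{comp}}_q(\mathbf a)$ denote the direct reading complexity of $\mathbf a=(a_n)_{n\ge 0}$: the minimal number of states of a deterministic finite automaton with output which, for every $n\ge 0$ and every base-$q$ expansion of $n$ (leading zeros being allowed), outputs $a_n$ after reading that expansion starting with the most significant digit. (i) If $\frac{\partial P}{\partial y}(0,0)\neq 0$ and $f(0)=0$, then $\overrightarrow{\mathrm{comp}}_q(\mathbf a)\le q^{1+(h+1)d}$. (ii) In general, the resultant $\mathrm{Res}_y\left(P,\frac{\partial P}{\partial y}\right)\in\mathbb F_q[x]$ is nonzero and, if $r$ denotes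 its order of vanishing at $x=0$, then $\overrightarrow{\mathrm{comp}}_q(\mathbf a)\le q^{1+(h+1)d+r}$. In particular, $\overrightarrow{\mathrm{comp}}_q(\mathbf a)\le q^{(3h+1)d-h+1}$. -/

import Mathlib

open Polynomial
open scoped PowerSeries LaurentSeries RatFunc

/-- A deterministic finite automaton with output: input alphabet `{0, …, q - 1}`, set of states
`{0, …, n - 1}`, output alphabet `K`. -/
structure DigitAutomaton (q n : ℕ) (K : Type*) where
  /-- the transition function -/
  step : Fin n → Fin q → Fin n
  /-- the initial state -/
  start : Fin n
  /-- the output function -/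
  output : Fin n → K

namespace DigitAutomaton

/-- The output after a word has been read from left to right. -/
def run {q n : ℕ} {K : Type*} (M : DigitAutomaton q n K) (w : List (Fin q)) : K :=
  M.output (w.foldl M.step M.start)

end DigitAutomaton

/-- The natural number whose base-`q` expansion is the word `w`, the most significant digit being
the leftmost one. Leading zeros are allowed, and the empty word represents `0`. -/
def msdValue (q : ℕ) (w : List (Fin q)) : ℕ :=
  Nat.ofDigits q (w.reverse.map Fin.val)

/-- `M` generates the sequence `a` in direct reading: when a base-`q` expansion of `k` is read
starting with the most significant digit, the output is `a k`. As usual, this has to hold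
irrespective of leading zeros. -/
def DigitAutomaton.GeneratesDirect {q n : ℕ} {K : Type*} (M : DigitAutomaton q n K)
    (a : ℕ → K) : Prop :=
  ∀ w : List (Fin q), M.run w = a (msdValue q w)

/-- The direct reading complexity of `a`: the least number of states of an automaton that generates
`a` in direct reading (`⊤` if there is no such finite automaton). -/
noncomputable def directComp {K : Type*} (q : ℕ) (a : ℕ → K) : ℕ∞ :=
  ⨅ (n : ℕ) (_ : ∃ M : DigitAutomaton q n K, M.GeneratesDirect a), (n : ℕ∞)

section Algebraic

variable {K : Type*} [Field K]

/-- A polynomial `P(x, y)` is an element of `K[X][X]`, with outer variable `y` and inner variable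
`x`. This is its degree in `x`. -/
noncomputable def degX (P : K[X][X]) : ℕ :=
  P.support.sup fun i => (P.coeff i).natDegree

/-- The power series `P(x, f(x))`. -/
noncomputable def evalAtSeries (P : K[X][X]) (f : K⟦X⟧) : K⟦X⟧ :=
  P.eval₂ (Polynomial.coeToPowerSeries.ringHom (R := K)) f

/-- The degree of `f`, that is `[K(x)(f) : K(x)]`, computed inside the field of Laurent series. -/
noncomputable def seriesDegree (f : K⟦X⟧) : ℕ :=
  Module.finrank (RatFunc K) (IntermediateField.adjoin (RatFunc K) {(f : K⸨X⸩)})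

/-- The height of `f`: the least degree in `x` of a nonzero polynomial `P(x, y)` such that
`P(x, f(x)) = 0`. -/
noncomputable def seriesHeight (f : K⟦X⟧) : ℕ :=
  sInf {h : ℕ | ∃ P : K[X][X], P ≠ 0 ∧ evalAtSeries P f = 0 ∧ degX P = h}

/-- `P(x, y) ∈ K[x, y]` is a minimal polynomial of `f` (unique up to a factor in `Kˣ`): it is
irreducible in `K[x, y]` and `P(x, f(x)) = 0`. -/
def IsMinimalPolynomial (f : K⟦X⟧) (P : K[X][X]) : Prop :=
  Irreducible P ∧ evalAtSeries P f = 0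

/-- The resultant, with respect to `y`, of `P(x, y)` and `∂P/∂y (x, y)`. -/
noncomputable def resultantDeriv (P : K[X][X]) : K[X] :=
  Polynomial.resultant P (derivative P)

end Algebraic

/-!
Sections of an algebraic series and automata in direct reading.

Let `q = |K|`, let `L = K((x))` and let `Λᵢ : ∑ aₙ xⁿ ↦ ∑ a_{qn+i} xⁿ` be the section operators on
`L`, where the sums extend over all integers `n`. If a finite-dimensional subspace `V` of `L`
contains `f` and is invariant under all `Λᵢ` with `0 ≤ i < q`, then the dual space of `V`, with the
transposed operators, is the state space of an automaton which reads the most significant digit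
first and outputs the coefficients of `f` (`directComp_le_card_pow_finrank`). So the direct reading
complexity of `f` is at most `q ^ dim V`.

A suitable `V` consists of the series `A(x, f) / P_y(x, f)`, where the degree of `A` is at most `h`
in `x` and less than `d` in `y`; its dimension is at most `(h + 1) d`. Its invariance
(`sectionOp_mem_sectionSpace`) is an algebraic version of the residue formula
`A(x, f) / P_y(x, f) = Res_{y = f} A / P` together with
`A / P = A P^(q-1) / P^q`: a section of `A / P` has the denominator `P` again, and its numerator is
a section of `A P^(q-1)` in both variables, which satisfies the same degree bounds as `A`. The
computation at `y = f` is `residueForm_mul_X_sub_C_pow`. Moreover `f` lies in `V`, because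
`f P_y(x, f)` is the value of `y P_y - d P`, a polynomial of degree less than `d` in `y`
(`self_mem_sectionSpace`).

This gives the bound `q ^ ((h + 1) d)` for every algebraic series
(`IsMinimalPolynomial.directComp_le`); neither the vanishing of `f` at the origin nor the order of
the resultant at `0` plays a role, and all the bounds of the theorem follow from it.

It remains to relate `P` to `d` and `h`, which is Gauss's lemma: `P` divides every polynomial that
vanishes at `y = f`. Finally `P_y(x, f) ≠ 0`, because otherwise both partial derivatives of `P`
would be zero and `P` would be a `p`-th power
(`IsMinimalPolynomial.evalAtSeries_derivative_ne_zero`). Hence `P` and `P_y` are coprime over `K(x)`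
and their resultant is nonzero.
-/

/-! ### Section operators on Laurent series -/

section Section

variable {K : Type*} [Field K]

/-- The `i`-th section operator of base `q`, sending `∑ aₙ xⁿ` to `∑ a_{qn+i} xⁿ`. The sums run
over all integers `n`, so it acts on Laurent series. -/
noncomputable def sectionOp (K : Type*) [Field K] (q : ℕ) [NeZero q] (i : ℕ) :
    K⸨X⸩ →ₗ[K] K⸨X⸩ where
  toFun g := HahnSeries.ofSuppBddBelow (fun n : ℤ => g.coeff (q * n + i)) <| by
    have hq : (1 : ℤ) ≤ q := by exact_mod_cast NeZero.one_le
    -- a crude lower bound: `n < -|ord g| - i` gives `q n + i ≤ n + i < ord g`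
    refine ⟨-|g.order| - i, fun n hn => ?_⟩
    have h1 : g.order ≤ q * n + i := HahnSeries.order_le_of_coeff_ne_zero hn
    by_contra! h
    have := neg_abs_le g.order
    have := abs_nonneg g.order
    nlinarith
  map_add' _ _ := rfl
  map_smul' _ _ := rfl

theorem sectionOp_coeff (q : ℕ) [NeZero q] (i : ℕ) (g : K⸨X⸩) (n : ℤ) :
    (sectionOp K q i g).coeff n = g.coeff (q * n + i) := rfl

theorem sectionOp_single (q : ℕ) [NeZero q] {i : ℕ} (e : ℕ) (c : K) (hi : i < q) :
    sectionOp K q i (HahnSeries.single (e : ℤ) c) =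
      if e % q = i then HahnSeries.single ((e / q : ℕ) : ℤ) c else 0 := by
  have hq : (q : ℤ) ≠ 0 := by exact_mod_cast NeZero.ne q
  have key : ∀ n : ℤ, (q : ℤ) * n + i = e ↔ e % q = i ∧ n = ((e / q : ℕ) : ℤ) := by
    intro n
    push_cast
    constructor
    · intro h
      have h1 : (e : ℤ) % q = i := by
        rw [← h, Int.mul_add_emod_self_left]
        exact Int.emod_eq_of_lt (by positivity) (by exact_mod_cast hi)
      have h2 := Int.mul_ediv_add_emod (e : ℤ) q
      refine ⟨by exact_mod_cast h1, mul_left_cancel₀ hq ?_⟩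
      linarith
    · rintro ⟨h1, rfl⟩
      rw [← h1]
      exact_mod_cast Nat.div_add_mod e q
  ext n
  rw [sectionOp_coeff, HahnSeries.coeff_single]
  simp only [key]
  split_ifs with h1 h2 h3 <;> simp_all

/-- The hypothesis on `w` says that `w(x) = u(x^q)`. -/
theorem sectionOp_mul (q : ℕ) [NeZero q] (i : ℕ) {u w v : K⸨X⸩}
    (hw : ∀ m : ℤ, w.coeff m = if (q : ℤ) ∣ m then u.coeff (m / q) else 0) :
    sectionOp K q i (w * v) = u * sectionOp K q i v := by
  have hq : (q : ℤ) ≠ 0 := by exact_mod_cast NeZero.ne q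
  ext n
  rw [sectionOp_coeff, HahnSeries.coeff_mul, HahnSeries.coeff_mul]
  refine Finset.sum_nbij' (fun x => (x.1 / q, n - x.1 / q)) (fun x => (q * x.1, q * x.2 + i))
    ?_ ?_ ?_ ?_ ?_
  all_goals
    rintro ⟨a, b⟩ hab
    simp only [Finset.mem_antidiagonal, HahnSeries.mem_support, hw,
      sectionOp_coeff, ne_eq, ite_eq_right_iff, Classical.not_imp] at hab ⊢
    obtain ⟨h1, h2, h3⟩ := hab
  · obtain ⟨⟨c, rfl⟩, h1⟩ := h1
    rw [Int.mul_ediv_cancel_left _ hq] at h1 ⊢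
    refine ⟨h1, ?_, by ring⟩
    convert h2 using 3
    linear_combination -h3
  · rw [Int.mul_ediv_cancel_left _ hq]
    exact ⟨⟨dvd_mul_right _ _, h1⟩, h2, by rw [← h3]; ring⟩
  · obtain ⟨⟨c, rfl⟩, h1⟩ := h1
    rw [Int.mul_ediv_cancel_left _ hq]
    ext <;> simp
    linear_combination -h3
  · rw [Int.mul_ediv_cancel_left _ hq]
    ext <;> simp
    linear_combination -h3
  · rw [if_pos h1.1]
    obtain ⟨⟨c, rfl⟩, h1⟩ := h1
    rw [Int.mul_ediv_cancel_left _ hq]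
    congr 2
    linear_combination h3

variable [Fintype K]

theorem PowerSeries.pow_card (g : K⟦X⟧) :
    g ^ Fintype.card K = PowerSeries.expand (Fintype.card K) Fintype.card_ne_zero g := by
  obtain ⟨p, hp⟩ := CharP.exists K
  obtain ⟨n, hpp, hn⟩ := FiniteField.card K p
  have := Fact.mk hpp
  have h : iterateFrobenius K p n = RingHom.id K := by
    ext x
    rw [iterateFrobenius_def, ← hn, FiniteField.pow_card, RingHom.id_apply]
  have := MvPowerSeries.map_iterateFrobenius_expand p hpp.ne_zero (g : MvPowerSeries Unit K) n
  rw [h, MvPowerSeries.map_id, RingHom.id_apply] at this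
  simp only [hn]
  exact this.symm

/-- Over `𝔽_q`, the `q`-th power of a Laurent series `u(x)` is `u(x^q)`. -/
theorem LaurentSeries.coeff_pow_card (u : K⸨X⸩) (m : ℤ) :
    (u ^ Fintype.card K).coeff m =
      if (Fintype.card K : ℤ) ∣ m then u.coeff (m / Fintype.card K) else 0 := by
  set q := Fintype.card K with hq
  have hq0 : (q : ℤ) ≠ 0 := by exact_mod_cast Fintype.card_ne_zero
  have hqpos : (0 : ℤ) < q := by positivity
  have hpow : u ^ q = HahnSeries.single (q * u.order) 1 *
      HahnSeries.ofPowerSeries ℤ K (u.powerSeriesPart ^ q) := by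
    conv_lhs => rw [← u.single_order_mul_powerSeriesPart]
    rw [mul_pow, HahnSeries.single_pow, one_pow, map_pow, nsmul_eq_mul]
  have hcoe : ∀ j : ℤ, u.coeff j =
      (HahnSeries.ofPowerSeries ℤ K u.powerSeriesPart).coeff (j - u.order) := by
    intro j
    conv_lhs => rw [← u.single_order_mul_powerSeriesPart]
    rw [HahnSeries.coeff_single_mul, one_mul]
  rw [hpow, HahnSeries.coeff_single_mul, one_mul, PowerSeries.pow_card, PowerSeries.coeff_coe]
  by_cases hm : (q : ℤ) ∣ m
  · obtain ⟨k, rfl⟩ := hm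
    rw [if_pos (dvd_mul_right _ _), Int.mul_ediv_cancel_left _ hq0, hcoe, PowerSeries.coeff_coe,
      ← mul_sub, Int.natAbs_mul, Int.natAbs_natCast, PowerSeries.coeff_expand_mul]
    have : (q : ℤ) * (k - u.order) < 0 ↔ k - u.order < 0 := by
      constructor <;> intro h <;> nlinarith
    simp only [this]
  · rw [if_neg hm, PowerSeries.coeff_expand_of_not_dvd, ite_self]
    rw [← Int.natCast_dvd]
    rwa [dvd_sub_left (dvd_mul_right _ _)]

theorem sectionOp_pow_card_mul [NeZero (Fintype.card K)] (i : ℕ) (u v : K⸨X⸩) :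
    sectionOp K (Fintype.card K) i (u ^ Fintype.card K * v) =
      u * sectionOp K (Fintype.card K) i v :=
  sectionOp_mul _ i (LaurentSeries.coeff_pow_card u)

end Section

/-! ### Sections of values of polynomials -/

section ResidueForm

variable {L : Type*} [Field L]

theorem X_sub_C_pow_expChar_pow_sub_one (p n : ℕ) [ExpChar L p] (f : L) :
    (X - C f) ^ (p ^ n - 1) =
      ∑ j ∈ Finset.range (p ^ n), X ^ j * (C f) ^ (p ^ n - 1 - j) := by
  have hpos : p ^ n ≠ 0 := (expChar_pow_pos L p n).ne'
  have hp : ExpChar L[X] p := inferInstance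
  refine mul_right_cancel₀ (X_sub_C_ne_zero f) ?_
  rw [(Commute.all _ _).geom_sum₂_mul, pow_sub_one_mul hpos, sub_pow_expChar_pow]

/-- The map `∑ cₖ yᵏ ↦ ∑ Λ(c_{qm+q-1}) fᵐ`, that is, the section of index `q - 1` with respect to
`y`, combined with `Λ` on the coefficients and followed by the evaluation at `y = f`. -/
noncomputable def residueForm (Λ : L →+ L) (q : ℕ) (f : L) : L[X] →ₗ[ℕ] L :=
  lsum fun k => if k % q = q - 1 then LinearMap.mulRight ℕ (f ^ (k / q)) ∘ₗ Λ.toNatLinearMap else 0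

theorem residueForm_monomial (Λ : L →+ L) (q : ℕ) (f c : L) (k : ℕ) :
    residueForm Λ q f (monomial k c) = if k % q = q - 1 then Λ c * f ^ (k / q) else 0 := by
  have : residueForm Λ q f (monomial k c) =
      (if k % q = q - 1 then LinearMap.mulRight ℕ (f ^ (k / q)) ∘ₗ Λ.toNatLinearMap else 0) c :=
    sum_monomial_index _ _ (LinearMap.map_zero _)
  rw [this]
  split_ifs <;> simp

/-- Among the monomials of `(y - f)^(q-1) = ∑ yʲ f^(q-1-j)` exactly one contributes to the
section of index `q - 1` of `yᵏ (y - f)^(q-1)`. This is an algebraic form of the fact that sections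
commute with the residue at `y = f`. -/
theorem residueForm_mul_X_sub_C_pow (Λ : L →+ L) (p n : ℕ) [ExpChar L p]
    (hΛ : ∀ u v, Λ (u ^ p ^ n * v) = u * Λ v) (f : L) (S : L[X]) :
    residueForm Λ (p ^ n) f (S * (X - C f) ^ (p ^ n - 1)) = Λ (S.eval f) := by
  have hpos : 0 < p ^ n := expChar_pow_pos L p n
  rw [X_sub_C_pow_expChar_pow_sub_one]
  generalize p ^ n = q at *
  induction S using Polynomial.induction_on' with
  | add S T hS hT => rw [add_mul, map_add, hS, hT, eval_add, map_add]
  | monomial k c =>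
    have hterm : ∀ j, monomial k c * (X ^ j * C f ^ (q - 1 - j)) =
        monomial (k + j) (c * f ^ (q - 1 - j)) := by
      intro j
      rw [← C_mul_X_pow_eq_monomial, ← C_mul_X_pow_eq_monomial, C_mul, C_pow, pow_add]
      ring
    rw [Finset.mul_sum, map_sum]
    simp only [hterm, residueForm_monomial]
    obtain ⟨r, m, hr, rfl⟩ : ∃ r m, r < q ∧ k = r + q * m :=
      ⟨k % q, k / q, Nat.mod_lt _ hpos, (Nat.mod_add_div k q).symm⟩
    have hmod : ∀ j, (r + q * m + j) % q = (r + j) % q := fun j => by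
      rw [add_right_comm, Nat.add_mul_mod_self_left]
    rw [Finset.sum_eq_single (q - 1 - r)]
    · have h1 : r + q * m + (q - 1 - r) = (q - 1) + q * m := by omega
      rw [h1, Nat.add_mul_mod_self_left, Nat.mod_eq_of_lt (by omega), if_pos rfl,
        Nat.add_mul_div_left _ _ hpos, Nat.div_eq_of_lt (by omega), zero_add, eval_monomial,
        show q - 1 - (q - 1 - r) = r by omega, pow_add, mul_comm q m, pow_mul,
        show c * (f ^ r * (f ^ m) ^ q) = (f ^ m) ^ q * (c * f ^ r) by ring, hΛ, mul_comm]
    · intro j hj hne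
      rw [Finset.mem_range] at hj
      rw [hmod, if_neg]
      intro h
      rcases lt_or_ge (r + j) q with h1 | h1
      · rw [Nat.mod_eq_of_lt h1] at h
        omega
      · rw [Nat.mod_eq_sub_mod h1, Nat.mod_eq_of_lt (by omega)] at h
        omega
    · intro h
      exact absurd (Finset.mem_range.2 (by omega)) h

end ResidueForm

/-! ### Degrees in the inner variable -/

section DegX

variable {K : Type*} [Field K]

theorem degX_le_iff {P : K[X][X]} {m : ℕ} : degX P ≤ m ↔ ∀ i, (P.coeff i).natDegree ≤ m := by
  refine Finset.sup_le_iff.trans ⟨fun h i => ?_, fun h i _ => h i⟩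
  by_cases hi : i ∈ P.support
  · exact h i hi
  · rw [notMem_support_iff.1 hi, natDegree_zero]
    exact m.zero_le

theorem natDegree_coeff_le_degX (P : K[X][X]) (i : ℕ) : (P.coeff i).natDegree ≤ degX P :=
  degX_le_iff.1 le_rfl i

theorem degX_mul_le (P Q : K[X][X]) : degX (P * Q) ≤ degX P + degX Q := by
  refine degX_le_iff.2 fun i => ?_
  rw [coeff_mul]
  refine natDegree_sum_le_of_forall_le _ _ fun x _ => natDegree_mul_le.trans ?_
  exact add_le_add (natDegree_coeff_le_degX P _) (natDegree_coeff_le_degX Q _)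

theorem degX_pow_le (P : K[X][X]) (n : ℕ) : degX (P ^ n) ≤ n * degX P := by
  induction n with
  | zero =>
    refine degX_le_iff.2 fun i => ?_
    rw [pow_zero, coeff_one]
    split_ifs <;> simp
  | succ n ih =>
    rw [pow_succ, add_mul, one_mul]
    exact (degX_mul_le _ _).trans (by gcongr)

theorem coeff_coeff_swap (P : K[X][X]) (i j : ℕ) :
    ((Bivariate.swap P).coeff i).coeff j = (P.coeff j).coeff i := by
  induction P using Polynomial.induction_on' with
  | add P Q hP hQ => simp only [map_add, coeff_add, hP, hQ]
  | monomial n c =>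
    induction c using Polynomial.induction_on' with
    | add c d hc hd => simp only [map_add, coeff_add, hc, hd]
    | monomial m a =>
      rw [Bivariate.swap_monomial_monomial, coeff_monomial, coeff_monomial]
      by_cases hm : m = i <;> by_cases hn : n = j <;> simp [hm, hn, coeff_monomial]

theorem degX_eq_natDegree_swap (P : K[X][X]) : degX P = (Bivariate.swap P).natDegree := by
  refine le_antisymm (degX_le_iff.2 fun i => natDegree_le_iff_coeff_eq_zero.2 fun k hk => ?_)
    (natDegree_le_iff_coeff_eq_zero.2 fun k hk => ?_)
  · rw [← coeff_coeff_swap, coeff_eq_zero_of_natDegree_lt hk, coeff_zero]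
  · ext j
    rw [coeff_coeff_swap, coeff_zero]
    exact coeff_eq_zero_of_natDegree_lt ((natDegree_coeff_le_degX P j).trans_lt hk)

theorem degX_le_of_dvd {P Q : K[X][X]} (h : P ∣ Q) (hQ : Q ≠ 0) : degX P ≤ degX Q := by
  obtain ⟨T, rfl⟩ := h
  have h0 : Bivariate.swap (P * T) ≠ 0 := fun h => hQ (by
    rw [← Bivariate.swap_swap_apply (P * T), h, map_zero])
  rw [degX_eq_natDegree_swap, degX_eq_natDegree_swap]
  rw [map_mul Bivariate.swap] at h0 ⊢
  exact natDegree_le_of_dvd (dvd_mul_right _ _) h0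

/-- The partial derivative `∂P/∂x`, taken on the coefficients. -/
noncomputable def derivX : K[X][X] →ₗ[K] K[X][X] :=
  lsum fun n => (monomial n).restrictScalars K ∘ₗ derivative

theorem derivX_monomial (n : ℕ) (c : K[X]) :
    derivX (monomial n c) = monomial n (derivative c) :=
  sum_monomial_index _ _ (LinearMap.map_zero _)

theorem coeff_derivX (P : K[X][X]) (i : ℕ) : (derivX P).coeff i = derivative (P.coeff i) := by
  induction P using Polynomial.induction_on' with
  | add P Q hP hQ => simp only [map_add, coeff_add, hP, hQ]
  | monomial n c =>
    rw [derivX_monomial, coeff_monomial, coeff_monomial]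
    split_ifs <;> simp

theorem degX_derivX_lt {P : K[X][X]} (h : derivX P ≠ 0) : degX (derivX P) < degX P := by
  have hpos : 0 < degX P := by
    by_contra! h0
    refine h (ext fun i => ?_)
    rw [coeff_derivX, coeff_zero]
    exact derivative_of_natDegree_zero
      (Nat.le_zero.1 ((natDegree_coeff_le_degX P i).trans h0))
  refine Nat.lt_of_le_pred hpos (degX_le_iff.2 fun i => ?_)
  rw [coeff_derivX]
  exact (natDegree_derivative_le _).trans
    (Nat.sub_le_sub_right (natDegree_coeff_le_degX P i) 1)

/-- The chain rule for `P(x, f(x))`. -/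
theorem derivative_evalAtSeries (P : K[X][X]) (f : K⟦X⟧) :
    PowerSeries.derivative K (evalAtSeries P f) =
      evalAtSeries (derivX P) f + evalAtSeries (derivative P) f * PowerSeries.derivative K f := by
  induction P using Polynomial.induction_on' with
  | add P Q hP hQ =>
    simp only [evalAtSeries, map_add, eval₂_add] at hP hQ ⊢
    rw [hP, hQ]
    ring
  | monomial n c =>
    have hc := PowerSeries.derivative_coe c
    simp only [evalAtSeries, derivX_monomial, derivative_monomial, eval₂_monomial,
      Derivation.leibniz, Derivation.leibniz_pow, map_mul, map_natCast, smul_eq_mul,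
      nsmul_eq_mul, Polynomial.coeToPowerSeries.ringHom_apply, hc]
    ring

end DegX

/-! ### The minimal polynomial of an algebraic series -/

section MinimalPolynomial

variable {K : Type*} [Field K] {f : K⟦X⟧} {P : K[X][X]}

theorem coe_evalAtSeries (Q : K[X][X]) (f : K⟦X⟧) :
    (evalAtSeries Q f : K⸨X⸩) = aeval (f : K⸨X⸩) (Q.map (algebraMap K[X] (RatFunc K))) := by
  rw [aeval_map_algebraMap, aeval_def, evalAtSeries, hom_eval₂]
  congr 1

theorem evalAtSeries_eq_zero_iff (Q : K[X][X]) (f : K⟦X⟧) :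
    evalAtSeries Q f = 0 ↔
      aeval (f : K⸨X⸩) (Q.map (algebraMap K[X] (RatFunc K))) = 0 := by
  rw [← coe_evalAtSeries, map_eq_zero_iff _ HahnSeries.ofPowerSeries_injective]

theorem IsMinimalPolynomial.natDegree_pos (hP : IsMinimalPolynomial f P) : 0 < P.natDegree := by
  by_contra! h
  obtain ⟨c, rfl⟩ := natDegree_eq_zero.1 (Nat.le_zero.1 h)
  have h0 : (c : K⟦X⟧) = 0 := by simpa [evalAtSeries] using hP.2
  exact hP.1.ne_zero (by rw [Polynomial.coe_eq_zero_iff.1 h0, C_0])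

theorem IsMinimalPolynomial.isPrimitive (hP : IsMinimalPolynomial f P) : P.IsPrimitive :=
  hP.1.isPrimitive hP.natDegree_pos.ne'

theorem IsMinimalPolynomial.irreducible_map (hP : IsMinimalPolynomial f P) :
    Irreducible (P.map (algebraMap K[X] (RatFunc K))) :=
  hP.isPrimitive.irreducible_iff_irreducible_map_fraction_map.1 hP.1

theorem IsMinimalPolynomial.minpoly_eq (hP : IsMinimalPolynomial f P) :
    P.map (algebraMap K[X] (RatFunc K)) *
        C (P.map (algebraMap K[X] (RatFunc K))).leadingCoeff⁻¹ =
      minpoly (RatFunc K) (f : K⸨X⸩) :=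
  minpoly.eq_of_irreducible hP.irreducible_map ((evalAtSeries_eq_zero_iff P f).1 hP.2)

theorem IsMinimalPolynomial.natDegree_eq (hP : IsMinimalPolynomial f P) :
    P.natDegree = seriesDegree f := by
  have hint : IsIntegral (RatFunc K) (f : K⸨X⸩) :=
    (show IsAlgebraic (RatFunc K) (f : K⸨X⸩) from ⟨_, hP.irreducible_map.ne_zero,
      (evalAtSeries_eq_zero_iff P f).1 hP.2⟩).isIntegral
  rw [seriesDegree, IntermediateField.adjoin.finrank hint, ← hP.minpoly_eq,
    natDegree_mul_C (inv_ne_zero (leadingCoeff_ne_zero.2 hP.irreducible_map.ne_zero)),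
    natDegree_map_eq_of_injective (IsFractionRing.injective _ _)]

theorem IsMinimalPolynomial.dvd_of_evalAtSeries_eq_zero (hP : IsMinimalPolynomial f P)
    {Q : K[X][X]} (hQ : evalAtSeries Q f = 0) : P ∣ Q := by
  refine hP.isPrimitive.dvd_of_fraction_map_dvd_fraction_map (K := RatFunc K) ?_
  refine (Dvd.intro _ hP.minpoly_eq).trans ?_
  exact minpoly.dvd _ _ ((evalAtSeries_eq_zero_iff Q f).1 hQ)

theorem IsMinimalPolynomial.degX_le (hP : IsMinimalPolynomial f P) : degX P ≤ seriesHeight f := by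
  obtain ⟨Q, hQ0, hQ, hQh⟩ := Nat.sInf_mem
    (s := {h : ℕ | ∃ P : K[X][X], P ≠ 0 ∧ evalAtSeries P f = 0 ∧ degX P = h})
    ⟨_, P, hP.1.ne_zero, hP.2, rfl⟩
  rw [seriesHeight, ← hQh]
  exact degX_le_of_dvd (hP.dvd_of_evalAtSeries_eq_zero hQ) hQ0

theorem exists_eq_pow_of_derivative_eq_zero [Fintype K] (p : ℕ) [Fact p.Prime] [CharP K p]
    {P : K[X][X]} (hy : derivative P = 0) (hx : derivX P = 0) : ∃ Q, P = Q ^ p := by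
  have hp : p ≠ 0 := (Fact.out : p.Prime).ne_zero
  -- the coefficients of `P`, having zero derivative, are `p`-th powers since `K` is perfect
  have hlift : contract p P ∈ lifts (frobenius K[X] p) := by
    refine (lifts_iff_coeff_lifts _).2 fun n => ?_
    rw [coeff_contract hp]
    have h : derivative (P.coeff (n * p)) = 0 := by rw [← coeff_derivX, hx, coeff_zero]
    refine ⟨(contract p (P.coeff (n * p))).map (frobeniusEquiv K p).symm, ?_⟩
    rw [frobenius_def, ← polynomial_expand_eq, expand_contract p h hp]
  obtain ⟨Q, hQ⟩ := (mem_lifts _).1 hlift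
  refine ⟨Q, ?_⟩
  rw [← map_frobenius_expand p, map_expand, hQ, expand_contract p hy hp]

/-- An algebraic series over a finite field is separable: if `∂P/∂y` vanished at `y = f`, then
`∂P/∂y = 0` for degree reasons, hence `∂P/∂x` would vanish at `y = f` by the chain rule and be zero
as well, and `P` would be a `p`-th power. -/
theorem IsMinimalPolynomial.evalAtSeries_derivative_ne_zero [Fintype K]
    (hP : IsMinimalPolynomial f P) : evalAtSeries (derivative P) f ≠ 0 := by
  intro h
  have hy : derivative P = 0 := by
    by_contra h0
    exact (natDegree_derivative_lt hP.natDegree_pos.ne').not_ge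
      (natDegree_le_of_dvd (hP.dvd_of_evalAtSeries_eq_zero h) h0)
  have hx : derivX P = 0 := by
    by_contra h0
    have h1 := derivative_evalAtSeries P f
    rw [hP.2, h, zero_mul, add_zero, map_zero] at h1
    exact (degX_derivX_lt h0).not_ge
      (degX_le_of_dvd (hP.dvd_of_evalAtSeries_eq_zero h1.symm) h0)
  obtain ⟨p, hp⟩ := CharP.exists K
  have := Fact.mk (CharP.char_is_prime K p)
  obtain ⟨Q, rfl⟩ := exists_eq_pow_of_derivative_eq_zero p hy hx
  exact not_irreducible_pow this.out.ne_one hP.1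

theorem IsMinimalPolynomial.resultantDeriv_ne_zero [Fintype K]
    (hP : IsMinimalPolynomial f P) : resultantDeriv P ≠ 0 := by
  have hinj : Function.Injective (algebraMap K[X] (RatFunc K)) := IsFractionRing.injective _ _
  intro h
  have h1 := congrArg (algebraMap K[X] (RatFunc K)) h
  rw [resultantDeriv, ← resultant_map_map, map_zero, ← natDegree_map_eq_of_injective hinj P,
    ← natDegree_map_eq_of_injective hinj (derivative P), resultant_eq_zero_iff] at h1
  refine h1.2 ((hP.irreducible_map.coprime_iff_not_dvd).2 fun hdvd => ?_)
  refine hP.evalAtSeries_derivative_ne_zero ((evalAtSeries_eq_zero_iff _ f).2 ?_)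
  obtain ⟨T, hT⟩ := hdvd
  rw [hT, map_mul, (evalAtSeries_eq_zero_iff P f).1 hP.2, zero_mul]

end MinimalPolynomial

/-! ### The invariant space of an algebraic series -/

section SectionSpace

variable {K : Type*} [Field K]

/-- The space of all `A(x, f) / w` with `A(x, y)` of degree at most `h` in `x` and less than `d` in
`y`. -/
noncomputable def sectionSpace (f w : K⸨X⸩) (h d : ℕ) : Submodule K K⸨X⸩ :=
  Submodule.span K (Set.range fun t : Fin (h + 1) × Fin d =>
    HahnSeries.single ((t.1 : ℕ) : ℤ) (1 : K) * f ^ (t.2 : ℕ) / w)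

instance (f w : K⸨X⸩) (h d : ℕ) : FiniteDimensional K (sectionSpace f w h d) :=
  FiniteDimensional.span_of_finite K (Set.finite_range _)

theorem finrank_sectionSpace_le (f w : K⸨X⸩) (h d : ℕ) :
    Module.finrank K (sectionSpace f w h d) ≤ (h + 1) * d :=
  (finrank_range_le_card _).trans (by simp)

theorem single_mul_pow_div_mem_sectionSpace (f w : K⸨X⸩) {h d e m : ℕ} (he : e ≤ h) (hm : m < d)
    (c : K) : HahnSeries.single (e : ℤ) c * f ^ m / w ∈ sectionSpace f w h d := by
  have : HahnSeries.single (e : ℤ) c * f ^ m / w =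
      c • (HahnSeries.single (e : ℤ) (1 : K) * f ^ m / w) := by
    rw [← HahnSeries.single_zero_mul_eq_smul, ← mul_div_assoc, ← mul_assoc,
      HahnSeries.single_mul_single, zero_add, mul_one]
  rw [this]
  exact Submodule.smul_mem _ _ (Submodule.subset_span
    ⟨(⟨e, Nat.lt_succ_of_le he⟩, ⟨m, hm⟩), rfl⟩)

theorem algebraMap_monomial_laurentSeries (e : ℕ) (c : K) :
    algebraMap K[X] K⸨X⸩ (monomial e c) = HahnSeries.single (e : ℤ) c := by
  rw [← C_mul_X_pow_eq_monomial]
  simp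

theorem aeval_div_mem_sectionSpace (f w : K⸨X⸩) {h d : ℕ} {A : K[X][X]} (hA : degX A ≤ h)
    (hd : A.natDegree < d) : aeval f A / w ∈ sectionSpace f w h d := by
  rw [aeval_eq_sum_range, Finset.sum_div]
  refine Submodule.sum_mem _ fun m hm => ?_
  have hm : m < d := (Nat.lt_succ_iff.1 (Finset.mem_range.1 hm)).trans_lt hd
  rw [Algebra.smul_def, (A.coeff m).as_sum_range' (h + 1)
    (Nat.lt_succ_of_le (degX_le_iff.1 hA m)), map_sum, Finset.sum_mul, Finset.sum_div]
  refine Submodule.sum_mem _ fun e he => ?_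
  rw [algebraMap_monomial_laurentSeries]
  exact single_mul_pow_div_mem_sectionSpace f w (Nat.lt_succ_iff.1 (Finset.mem_range.1 he)) hm _

/-- Sections in both variables map polynomials of bidegree at most `(q h, q d - 1)` to polynomials
of bidegree at most `(h, d - 1)`. -/
theorem residueForm_sectionOp_div_mem_sectionSpace (q : ℕ) [NeZero q] {i : ℕ} (hi : i < q)
    (f w : K⸨X⸩) {h d : ℕ} {A : K[X][X]} (hA : degX A ≤ q * h) (hd : A.natDegree < q * d) :
    residueForm (sectionOp K q i : K⸨X⸩ →+ K⸨X⸩) q f (A.map (algebraMap K[X] K⸨X⸩)) / w ∈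
      sectionSpace f w h d := by
  rw [A.as_sum_range, Polynomial.map_sum, map_sum, Finset.sum_div]
  refine Submodule.sum_mem _ fun k hk => ?_
  have hk : k < q * d := (Nat.lt_succ_iff.1 (Finset.mem_range.1 hk)).trans_lt hd
  rw [map_monomial, residueForm_monomial]
  split_ifs with hkq
  · rw [(A.coeff k).as_sum_range' (q * h + 1) (Nat.lt_succ_of_le (degX_le_iff.1 hA k)), map_sum,
      map_sum, Finset.sum_mul, Finset.sum_div]
    refine Submodule.sum_mem _ fun e he => ?_
    rw [AddMonoidHom.coe_coe, algebraMap_monomial_laurentSeries, sectionOp_single q e _ hi]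
    split_ifs
    · exact single_mul_pow_div_mem_sectionSpace f w
        (Nat.div_le_of_le_mul (Nat.lt_succ_iff.1 (Finset.mem_range.1 he)))
        (Nat.div_lt_of_lt_mul hk) _
    · simp
  · simp

theorem coe_evalAtSeries_eq_aeval (Q : K[X][X]) (f : K⟦X⟧) :
    (evalAtSeries Q f : K⸨X⸩) = aeval (f : K⸨X⸩) Q := by
  rw [coe_evalAtSeries, aeval_map_algebraMap]

variable [Fintype K] {f : K⟦X⟧} {P : K[X][X]}

/-- The space of all `A(x, f) / P_y(x, f)`, with `A` bounded by the bidegree of `P` (strictly in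
`y`), is invariant under sections. Writing `P = (y - f) R` over the Laurent series, one has
`P_y(x, f) = R(f)` and `Λ(A(f) / R(f)) R(f) = Λ(A(f) R(f)^(q-1))`, and the right-hand side is
computed from the polynomial `A P^(q-1) = A R^(q-1) (y - f)^(q-1)`. -/
theorem sectionOp_mem_sectionSpace [NeZero (Fintype.card K)] (hP : IsMinimalPolynomial f P)
    {h : ℕ} (hh : degX P ≤ h) {i : ℕ} (hi : i < Fintype.card K) {g : K⸨X⸩}
    (hg : g ∈ sectionSpace (f : K⸨X⸩) (evalAtSeries (derivative P) f : K⸨X⸩) h P.natDegree) :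
    sectionOp K (Fintype.card K) i g ∈
      sectionSpace (f : K⸨X⸩) (evalAtSeries (derivative P) f : K⸨X⸩) h P.natDegree := by
  obtain ⟨p, hp⟩ := CharP.exists K
  obtain ⟨n, hpp, hn⟩ := FiniteField.card K p
  have := Fact.mk hpp
  have : CharP K⸨X⸩ p := charP_of_injective_algebraMap (algebraMap K K⸨X⸩).injective p
  have hmul := sectionOp_pow_card_mul (K := K) i
  have hcard : 0 < Fintype.card K := Fintype.card_pos
  have hw0 : (evalAtSeries (derivative P) f : K⸨X⸩) ≠ 0 :=
    (map_ne_zero_iff _ HahnSeries.ofPowerSeries_injective).2 hP.evalAtSeries_derivative_ne_zero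
  have hwdef := coe_evalAtSeries_eq_aeval (derivative P) f
  have hroot := coe_evalAtSeries_eq_aeval P f
  rw [hP.2, map_zero] at hroot
  generalize (evalAtSeries (derivative P) f : K⸨X⸩) = w at *
  generalize (f : K⸨X⸩) = F at *
  obtain ⟨R, hR⟩ : X - C F ∣ P.map (algebraMap K[X] K⸨X⸩) := by
    rw [dvd_iff_isRoot, IsRoot.def, eval_map_algebraMap, ← hroot]
  have hRF : R.eval F = w := by
    rw [hwdef, ← eval_map_algebraMap, ← derivative_map, hR, derivative_mul]
    simp
  induction hg using Submodule.span_induction with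
  | zero => rw [map_zero]; exact Submodule.zero_mem _
  | add u v _ _ hu hv => rw [map_add]; exact Submodule.add_mem _ hu hv
  | smul c u _ hu => rw [map_smul]; exact Submodule.smul_mem _ _ hu
  | mem g hg =>
    obtain ⟨⟨a, b⟩, rfl⟩ := hg
    dsimp only
    set A : K[X][X] := monomial (b : ℕ) (monomial (a : ℕ) (1 : K)) with hA
    have hAF : (A.map (algebraMap K[X] K⸨X⸩)).eval F =
        HahnSeries.single ((a : ℕ) : ℤ) (1 : K) * F ^ (b : ℕ) := by
      rw [hA, map_monomial, eval_monomial, algebraMap_monomial_laurentSeries]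
    have hAx : degX A ≤ h := degX_le_iff.2 fun k => by
      rw [hA, coeff_monomial]
      split_ifs
      · exact (natDegree_monomial_le _).trans (Nat.lt_succ_iff.1 a.2)
      · simp
    have hAy : A.natDegree < P.natDegree := (natDegree_monomial_le _).trans_lt b.2
    have key : sectionOp K (Fintype.card K) i
          (HahnSeries.single ((a : ℕ) : ℤ) (1 : K) * F ^ (b : ℕ) / w) =
        residueForm (sectionOp K (Fintype.card K) i : K⸨X⸩ →+ K⸨X⸩) (Fintype.card K) F
          ((A * P ^ (Fintype.card K - 1)).map (algebraMap K[X] K⸨X⸩)) / w := by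
      have h1 : (A * P ^ (Fintype.card K - 1)).map (algebraMap K[X] K⸨X⸩) =
          (A.map (algebraMap K[X] K⸨X⸩) * R ^ (Fintype.card K - 1)) *
            (X - C F) ^ (Fintype.card K - 1) := by
        rw [Polynomial.map_mul, Polynomial.map_pow, hR, mul_pow]
        ring
      have h2 := residueForm_mul_X_sub_C_pow
        (sectionOp K (Fintype.card K) i : K⸨X⸩ →+ K⸨X⸩) p n
        (by rw [← hn]; exact hmul) F (A.map (algebraMap K[X] K⸨X⸩) * R ^ (Fintype.card K - 1))
      rw [← hn, AddMonoidHom.coe_coe] at h2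
      -- `1 / w = w^(q-1) / w^q`, and the denominator `w^q` leaves the section as `w`
      rw [h1, h2, eval_mul, eval_pow, hAF, hRF, eq_div_iff hw0, mul_comm, ← hmul]
      congr 1
      rw [← pow_sub_one_mul hcard.ne' w]
      field_simp
    rw [key]
    refine residueForm_sectionOp_div_mem_sectionSpace _ hi F w ?_ ?_
    · refine (degX_mul_le _ _).trans ((add_le_add hAx (degX_pow_le _ _)).trans ?_)
      calc h + (Fintype.card K - 1) * degX P ≤ h + (Fintype.card K - 1) * h := by gcongr
        _ = (1 + (Fintype.card K - 1)) * h := by ring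
        _ = Fintype.card K * h := by rw [Nat.add_sub_cancel' hcard]
    · refine (natDegree_mul_le.trans (add_le_add_right natDegree_pow_le _)).trans_lt ?_
      calc A.natDegree + (Fintype.card K - 1) * P.natDegree
          < P.natDegree + (Fintype.card K - 1) * P.natDegree := by gcongr
        _ = (1 + (Fintype.card K - 1)) * P.natDegree := by ring
        _ = Fintype.card K * P.natDegree := by rw [Nat.add_sub_cancel' hcard]

/-- Modulo `P`, the polynomial `y P_y` is congruent to `y P_y - d P`, whose degree in `y` is less
than `d = deg_y P`. -/
theorem self_mem_sectionSpace (hP : IsMinimalPolynomial f P) {h : ℕ} (hh : degX P ≤ h) :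
    (f : K⸨X⸩) ∈
      sectionSpace (f : K⸨X⸩) (evalAtSeries (derivative P) f : K⸨X⸩) h P.natDegree := by
  set A : K[X][X] := X * derivative P - P.natDegree • P with hA
  have hcoeff : ∀ k, A.coeff k = ((k : K) - P.natDegree) • P.coeff k := by
    intro k
    cases k with
    | zero => simp [hA, Algebra.smul_def]
    | succ k =>
      simp [hA, coeff_X_mul, coeff_derivative, Algebra.smul_def]
      ring
  have hAx : degX A ≤ h := degX_le_iff.2 fun k => by
    rw [hcoeff]
    exact (natDegree_smul_le _ _).trans ((natDegree_coeff_le_degX P k).trans hh)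
  have hAy : A.natDegree < P.natDegree := by
    refine Nat.lt_of_le_pred hP.natDegree_pos (natDegree_le_iff_coeff_eq_zero.2 fun k hk => ?_)
    rw [hcoeff]
    rcases (Nat.le_of_pred_lt hk).eq_or_lt with rfl | hk
    · rw [sub_self, zero_smul]
    · rw [coeff_eq_zero_of_natDegree_lt hk, smul_zero]
  have hw0 : (evalAtSeries (derivative P) f : K⸨X⸩) ≠ 0 :=
    (map_ne_zero_iff _ HahnSeries.ofPowerSeries_injective).2 hP.evalAtSeries_derivative_ne_zero
  have hroot := coe_evalAtSeries_eq_aeval P f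
  rw [hP.2, map_zero] at hroot
  have hmem := aeval_div_mem_sectionSpace (f : K⸨X⸩)
    (evalAtSeries (derivative P) f : K⸨X⸩) hAx hAy
  have hval : aeval (f : K⸨X⸩) A = f * (evalAtSeries (derivative P) f : K⸨X⸩) := by
    rw [hA, coe_evalAtSeries_eq_aeval, map_sub, map_mul, aeval_X, map_nsmul, ← hroot, smul_zero,
      sub_zero]
  rwa [hval, mul_div_cancel_right₀ _ hw0] at hmem

end SectionSpace

/-! ### Automata from invariant spaces -/

section Automata

theorem directComp_le_card {K S : Type*} [Fintype S] {q : ℕ} {a : ℕ → K} (step : S → Fin q → S)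
    (start : S) (output : S → K)
    (hrun : ∀ w : List (Fin q), output (w.foldl step start) = a (msdValue q w)) :
    directComp q a ≤ Fintype.card S := by
  let e := Fintype.equivFin S
  let M : DigitAutomaton q (Fintype.card S) K :=
    ⟨fun s i => e (step (e.symm s) i), e start, fun s => output (e.symm s)⟩
  have hM : ∀ (w : List (Fin q)) (s : S), w.foldl M.step (e s) = e (w.foldl step s) := by
    intro w
    induction w with
    | nil => exact fun s => rfl
    | cons i w ih =>
      intro s
      rw [List.foldl_cons, List.foldl_cons, ← ih]
      simp [M]
  refine iInf₂_le _ ⟨M, fun w => ?_⟩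
  rw [← hrun w, DigitAutomaton.run, show M.start = e start from rfl, hM]
  simp [M]

theorem msdValue_cons (q : ℕ) (i : Fin q) (w : List (Fin q)) :
    msdValue q (i :: w) = q ^ w.length * i + msdValue q w := by
  simp [msdValue, Nat.ofDigits_append, add_comm]

variable {K : Type*} [Field K]

theorem coeff_foldr_sectionOp (q : ℕ) [NeZero q] (g : K⸨X⸩) (w : List (Fin q)) (n : ℤ) :
    (w.foldr (fun i : Fin q => sectionOp K q i) g).coeff n =
      g.coeff (q ^ w.length * n + msdValue q w) := by
  induction w generalizing n with
  | nil => simp [msdValue]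
  | cons i w ih =>
    rw [List.foldr_cons, sectionOp_coeff, ih, msdValue_cons, List.length_cons]
    congr 1
    push_cast
    ring

/-- The states are the linear forms on an invariant space `V` containing `f`. The initial state is
the constant coefficient, the digit `i` acts by the transpose of the `i`-th section operator, and
the output is the value at `f`. Transposition reverses the order of the operators, which is why
the most significant digit is read first. -/
theorem directComp_le_card_pow_finrank [Fintype K] (q : ℕ) [NeZero q] (f : K⟦X⟧)
    (V : Submodule K K⸨X⸩) [FiniteDimensional K V] (hf : (f : K⸨X⸩) ∈ V)
    (hV : ∀ i < q, ∀ g ∈ V, sectionOp K q i g ∈ V) :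
    directComp q (fun n => PowerSeries.coeff n f) ≤
      ((Fintype.card K ^ Module.finrank K V : ℕ) : ℕ∞) := by
  let T : Fin q → V →ₗ[K] V := fun i => (sectionOp K q i).restrict (hV i i.2)
  let c : Module.Dual K V :=
    { toFun := fun g => (g : K⸨X⸩).coeff 0
      map_add' := fun _ _ => rfl
      map_smul' := fun _ _ => rfl }
  have : Finite (Module.Dual K V) := Module.finite_of_finite K
  have := Fintype.ofFinite (Module.Dual K V)
  have hfold : ∀ (w : List (Fin q)) (l : Module.Dual K V) (g : V),
      (w.foldl (fun l i => l ∘ₗ T i) l) g = l (w.foldr (fun i => T i) g) := by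
    intro w
    induction w with
    | nil => exact fun l g => rfl
    | cons i w ih =>
      intro l g
      rw [List.foldl_cons, ih, List.foldr_cons, LinearMap.comp_apply]
  have hcoe : ∀ (w : List (Fin q)) (g : V),
      ((w.foldr (fun i => T i) g : V) : K⸨X⸩) = w.foldr (fun i : Fin q => sectionOp K q i) (g : K⸨X⸩) := by
    intro w g
    induction w with
    | nil => rfl
    | cons i w ih => rw [List.foldr_cons, List.foldr_cons, ← ih]; rfl
  have hcard : Fintype.card (Module.Dual K V) = Fintype.card K ^ Module.finrank K V := by
    rw [Module.card_eq_pow_finrank (K := K), Subspace.dual_finrank_eq]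
  rw [← hcard]
  refine directComp_le_card (fun l i => l ∘ₗ T i) c (fun l => l ⟨f, hf⟩) fun w => ?_
  rw [hfold]
  change ((w.foldr (fun i => T i) ⟨f, hf⟩ : V) : K⸨X⸩).coeff 0 = _
  rw [hcoe, coeff_foldr_sectionOp, mul_zero, zero_add, LaurentSeries.coeff_coe_powerSeries]

theorem IsMinimalPolynomial.directComp_le [Fintype K] {f : K⟦X⟧} {P : K[X][X]}
    (hP : IsMinimalPolynomial f P) :
    directComp (Fintype.card K) (fun n => PowerSeries.coeff n f) ≤
      ((Fintype.card K ^ ((seriesHeight f + 1) * seriesDegree f) : ℕ) : ℕ∞) := by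
  have : NeZero (Fintype.card K) := ⟨Fintype.card_ne_zero⟩
  refine (directComp_le_card_pow_finrank (Fintype.card K) f _
    (self_mem_sectionSpace hP hP.degX_le)
    fun i hi g hg => sectionOp_mem_sectionSpace hP hP.degX_le hi hg).trans ?_
  rw [← hP.natDegree_eq]
  exact_mod_cast Nat.pow_le_pow_right Fintype.card_pos (finrank_sectionSpace_le _ _ _ _)

end Automata

theorem mainTheorem3 {K : Type*} [Field K] [Fintype K] (q : ℕ) (hq : q = Fintype.card K)
    (f : K⟦X⟧) (hf : IsAlgebraic (RatFunc K) (f : K⸨X⸩))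
    (P : K[X][X]) (hP : IsMinimalPolynomial f P)
    (d h : ℕ) (hd : d = seriesDegree f) (hh : h = seriesHeight f) :
    ((derivative P).evalEval 0 0 ≠ 0 → PowerSeries.constantCoeff f = 0 →
      directComp q (fun n => PowerSeries.coeff n f) ≤ ((q ^ (1 + (h + 1) * d) : ℕ) : ℕ∞)) ∧
    (resultantDeriv P ≠ 0 ∧
      (∀ r : ℕ, r = (resultantDeriv P).rootMultiplicity 0 →
        directComp q (fun n => PowerSeries.coeff n f) ≤
          ((q ^ (1 + (h + 1) * d + r) : ℕ) : ℕ∞)) ∧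
      directComp q (fun n => PowerSeries.coeff n f) ≤
        ((q ^ ((3 * h + 1) * d - h + 1) : ℕ) : ℕ∞)) := by
  have hd0 : 0 < d := by rw [hd, ← hP.natDegree_eq]; exact hP.natDegree_pos
  have hbound : ∀ m, (h + 1) * d ≤ m →
      directComp q (fun n => PowerSeries.coeff n f) ≤ ((q ^ m : ℕ) : ℕ∞) := by
    intro m hm
    subst hq hd hh
    refine hP.directComp_le.trans ?_
    exact_mod_cast Nat.pow_le_pow_right Fintype.card_pos hm
  refine ⟨fun _ _ => hbound _ (Nat.le_add_left _ _), hP.resultantDeriv_ne_zero,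
    fun r _ => hbound _ (by omega), hbound _ ?_⟩
  have h1 : h ≤ h * d := Nat.le_mul_of_pos_right h hd0
  have h2 : (3 * h + 1) * d = (h + 1) * d + h * d + h * d := by ring
  omega
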